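/- \textbf{Lemma (Transformation into the modulo-$q$ sum channel).} Let $q$ be a prime, $G=(V,E)$ a finite directed graph, $t_1,\dots,t_K\in V$ ($K\ge 1$) senders and $d\in V$ a receiver with $d\notin\{t_1,\dots,t_K\}$. Let $\alpha_v,\beta_v\in\mathbb{N}_0$ for $v\in V$, and let $h_{u,v}\in\mathbb{F}_q^{\beta_v\times\alpha_u}$ for $(u,v)\in E$. In the corresponding linear finite field network, at each time $t$ node $u$ transmits $x_u^{(t)}\in\mathbb{F}_q^{\alpha_u}$ and node $v$ receives $$y_v^{(t)}=\bigoplus_{u:(u,v)\in E}h_{u,v}\,x_u^{(t)}\in\mathbb{F}_q^{\beta_v}.$$ For $i\in[1:K]$ let $V_i$ be the set of nodes that can be reached from $t_i$ by a directed path (including $t_i$), and let $\Lambda(\{i\})$ be the set of all $\Omega\subseteq V_i$ with $t_i\in\Omega$ and $d\notin\Omega$. For $\Omega\in\Lambda(\{i\})$ let $H_\Omega(\{i\})$ be the matrix that maps $(x_u)_{u\in\Omega}$ to $\bigl(\bigoplus_{u\in\Omega,(u,v)\in E}h_{u,v}x_u\bigr)_{v\in V_i\setminus\Omega}$. Put $$C=\min_{i\in[1:K]}\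 \min_{\Omega\in\Lambda(\{i\})}\operatorname{rank} H_\Omega(\{i\}).$$ (1) \emph{(Arbitrary networks.)} There are integers $m_n\ge 0$ with $m_n/n\to C$ as $n\to\infty$ such that, for every $n$, some linear code over $n$ uses of the network transforms it into the modulo-$q$ sum channel $$\mathbf{y}'_d=\bigoplus_{i=1}^K\mathbf{x}'_{t_i},\qquad \mathbf{x}'_{t_i}\in\mathbb{F}_q^{m_n}.$$ That is: at each time $t$ every node other than $d$ transmits a linear function of its received signals at times before $t$ and, if it is a sender, of its message(s) $\mathbf{x}'_{t_i}$; the receiver is silent ($x_d^{(t)}=0$) and computes a linear function $\mathbf{y}'_d$ of $y_d^{(1)},\dots,y_d^{(n)}$; and the displayed equation holds for all values of the messages. (2) \emph{(Layered networks.)} Suppose that $V$ can be partitioned into layers $V[1],\dots,V[M]$ with $V[1]=\{t_1,\dots,t_K\}$ and $V[M]=\{d\}$, such that every edge goes from some $V[j]$ to $V[j+1]$. Consider the length-$n$ time-extended network $\mathbf{y}_v=\bigoplus_{u:(u,v)\in E}\mathbf{H}_{u,v}\mathbf{x}_u$, where $\mathbf{H}_{u,v}$ is block diagonal with $n$ blocks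 $h_{u,v}$ and every node other than $d$ transmits a block $\mathbf{x}_v$ that is a linear function of its whole received block $\mathbf{y}_v$ and, if it is a sender, of its message(s). Then for all sufficiently large $n$ the matrices of these linear functions, and of a linear function $\mathbf{y}'_d$ of $\mathbf{y}_d$, can be chosen so that $$\mathbf{y}'_d=\bigoplus_{i=1}^K\mathbf{x}'_{t_i}\quad\text{for all }\ \mathbf{x}'_{t_1},\dots,\mathbf{x}'_{t_K}\in\mathbb{F}_q^{nC}.$$ -/

import Mathlib

open scoped Matrix Kronecker

/-- A linear finite field network over `ZMod q` on the node set `V`, with senders `sender i`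
(`i : Fin K`) and one receiver. Node `u` sends a vector of length `α u` and node `v` receives a
vector of length `β v` at each time; `h u v` is the channel matrix of the edge `(u, v)`
(its value is irrelevant when `(u, v)` is not an edge). -/
structure FFNetwork (q : ℕ) (V : Type*) (K : ℕ) where
  graph : Digraph V
  α : V → ℕ
  β : V → ℕ
  h : ∀ u v : V, Matrix (Fin (β v)) (Fin (α u)) (ZMod q)
  sender : Fin K → V
  receiver : V
  sender_ne_receiver : ∀ i, sender i ≠ receiver

namespace FFNetwork

variable {q : ℕ} {V : Type*} {K : ℕ}

section Cuts

/-- The nodes that can be reached from sender `i` by a directed path. -/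
def reach (N : FFNetwork q V K) (i : Fin K) : Set V :=
  {v | Relation.ReflTransGen N.graph.Adj (N.sender i) v}

/-- The cuts dividing sender `i` from the receiver on the subgraph of the nodes that can be
reached from sender `i`. A cut is given by its sender side. -/
def cuts (N : FFNetwork q V K) (i : Fin K) : Set (Finset V) :=
  {Ω | (Ω : Set V) ⊆ N.reach i ∧ N.sender i ∈ Ω ∧ N.receiver ∉ Ω}

theorem cuts_nonempty (N : FFNetwork q V K) (i : Fin K) : (N.cuts i).Nonempty := by
  refine ⟨{N.sender i}, ?_, by simp, ?_⟩
  · intro v hv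
    have hv' : v = N.sender i := by simpa using hv
    subst hv'
    exact Relation.ReflTransGen.refl
  · simpa using (N.sender_ne_receiver i).symm

open Classical in
/-- The transfer matrix of the cut `Ω` on the subgraph of the nodes reachable from sender `i`:
its columns are the transmit symbols of the nodes in `Ω`, its rows are the receive symbols of the
other nodes of that subgraph. -/
noncomputable def transferMatrix (N : FFNetwork q V K) (i : Fin K) (Ω : Finset V) :
    Matrix (Σ v : {v : V // v ∈ N.reach i ∧ v ∉ Ω}, Fin (N.β v))
      (Σ u : {u : V // u ∈ Ω}, Fin (N.α u)) (ZMod q) :=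
  fun r c => if N.graph.Adj c.1 r.1 then N.h c.1 r.1 r.2 c.2 else 0

/-- The smallest rank of a transfer matrix over the cuts for sender `i`. -/
noncomputable def minCutRank (N : FFNetwork q V K) (i : Fin K) : ℕ :=
  ⨅ Ω : N.cuts i, (N.transferMatrix i Ω).rank

/-- The minimum over the senders of the min-cut rank. -/
noncomputable def capacity (N : FFNetwork q V K) : ℕ :=
  ⨅ i : Fin K, N.minCutRank i

end Cuts

section Causal

/-- A linear code over `n` uses of the network, for messages of length `m`.
`pre v i t` is applied at time `t` by node `v` to the message of sender `i` (used only if `v` is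
that sender), `relay v t s` is applied at time `t` by node `v` to what it received at time `s`
(used only for `s < t`), and `dec t` is applied by the receiver to what it received at time `t`.
Times are numbered `0, …, n - 1`. -/
structure LinearCode (N : FFNetwork q V K) (n m : ℕ) where
  pre : ∀ (v : V) (_ : Fin K) (_ : ℕ), Matrix (Fin (N.α v)) (Fin m) (ZMod q)
  relay : ∀ (v : V) (_ _ : ℕ), Matrix (Fin (N.α v)) (Fin (N.β v)) (ZMod q)
  dec : Fin n → Matrix (Fin m) (Fin (N.β N.receiver)) (ZMod q)

open Classical in
/-- One use of the channel: the sum of `h u v * x u` over the edges `(u, v)` into `v`. -/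
noncomputable def channel [Fintype V] (N : FFNetwork q V K)
    (x : ∀ u : V, Fin (N.α u) → ZMod q) (v : V) : Fin (N.β v) → ZMod q :=
  ∑ u : V with N.graph.Adj u v, N.h u v *ᵥ x u

open Classical in
/-- The signal transmitted at time `t` when the senders have the messages `x'`. A node combines
its own messages linearly with what it received strictly before time `t`; the receiver is
silent. -/
noncomputable def LinearCode.transmit [Fintype V] {N : FFNetwork q V K} {n m : ℕ}
    (c : N.LinearCode n m) (x' : Fin K → Fin m → ZMod q) (t : ℕ) (v : V) :
    Fin (N.α v) → ZMod q :=
  if v = N.receiver then 0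
  else ∑ i : Fin K with N.sender i = v, c.pre v i t *ᵥ x' i +
    ∑ s : Fin t, c.relay v t s *ᵥ N.channel (fun u => c.transmit x' s u) v
termination_by t
decreasing_by exact s.isLt

/-- The linear combination of its `n` received signals that the receiver forms. -/
noncomputable def LinearCode.output [Fintype V] {N : FFNetwork q V K} {n m : ℕ}
    (c : N.LinearCode n m) (x' : Fin K → Fin m → ZMod q) : Fin m → ZMod q :=
  ∑ t : Fin n, c.dec t *ᵥ N.channel (c.transmit x' t) N.receiver

/-- Some linear code turns `n` uses of the network into the modulo-`q` sum channel of length `m`: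
the receiver obtains exactly the sum of the messages, whatever the messages are. -/
def TransformsInto [Fintype V] (N : FFNetwork q V K) (n m : ℕ) : Prop :=
  ∃ c : N.LinearCode n m, ∀ x' : Fin K → Fin m → ZMod q, c.output x' = ∑ i, x' i

end Causal

section Layered

/-- The nodes split into layers `1, …, M`, with edges only from a layer to the next one; the
first layer is the set of senders, and the last layer consists of the receiver. -/
def IsLayered (N : FFNetwork q V K) : Prop :=
  ∃ (M : ℕ) (layer : V → ℕ), (∀ v, 1 ≤ layer v ∧ layer v ≤ M) ∧
    (∀ v, layer v = 1 ↔ v ∈ Set.range N.sender) ∧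
    (∀ v, layer v = M ↔ v = N.receiver) ∧
    ∀ u v, N.graph.Adj u v → layer v = layer u + 1

/-- The time-extended channel matrix of the edge `(u, v)` over `n` uses: block diagonal with `n`
blocks `h u v`. -/
def extendedMatrix (N : FFNetwork q V K) (n : ℕ) (u v : V) :
    Matrix (Fin n × Fin (N.β v)) (Fin n × Fin (N.α u)) (ZMod q) :=
  (1 : Matrix (Fin n) (Fin n) (ZMod q)) ⊗ₖ N.h u v

open Classical in
/-- The time-extended channel over `n` uses. -/
noncomputable def extendedChannel [Fintype V] (N : FFNetwork q V K) (n : ℕ)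
    (x : ∀ u : V, Fin n × Fin (N.α u) → ZMod q) (v : V) : Fin n × Fin (N.β v) → ZMod q :=
  ∑ u : V with N.graph.Adj u v, N.extendedMatrix n u v *ᵥ x u

/-- A linear block code for the time-extended network: every node maps its whole received block,
and each sender its message, linearly to its transmitted block. -/
structure BlockCode (N : FFNetwork q V K) (n m : ℕ) where
  pre : ∀ (v : V) (_ : Fin K), Matrix (Fin n × Fin (N.α v)) (Fin m) (ZMod q)
  relay : ∀ v : V, Matrix (Fin n × Fin (N.α v)) (Fin n × Fin (N.β v)) (ZMod q)
  dec : Matrix (Fin m) (Fin n × Fin (N.β N.receiver)) (ZMod q)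

open Classical in
/-- The transmitted blocks `x` are those that the code produces from the messages `x'`. -/
def BlockCode.IsRun [Fintype V] {N : FFNetwork q V K} {n m : ℕ} (c : N.BlockCode n m)
    (x' : Fin K → Fin m → ZMod q) (x : ∀ u : V, Fin n × Fin (N.α u) → ZMod q) : Prop :=
  x N.receiver = 0 ∧ ∀ v, v ≠ N.receiver →
    x v = ∑ i : Fin K with N.sender i = v, c.pre v i *ᵥ x' i +
      c.relay v *ᵥ N.extendedChannel n x v

/-- Some linear block code turns the time-extended network of length `n` into the modulo-`q` sum
channel of length `m`. -/
def BlockTransformsInto [Fintype V] (N : FFNetwork q V K) (n m : ℕ) : Prop :=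
  ∃ c : N.BlockCode n m, ∀ x' : Fin K → Fin m → ZMod q,
    (∃! x, c.IsRun x' x) ∧
      ∀ x, c.IsRun x' x → c.dec *ᵥ N.extendedChannel n x N.receiver = ∑ i, x' i

end Layered

end FFNetwork

/-!
The idea is to reverse the network. Transposing all matrices and reversing time turns a linear
code with which the receiver obtains `∑ i, x' i` into a linear code with which the receiver
broadcasts one vector `w` over the reversed network, every sender recovering all of `w`: the
transfer matrix from sender `i` to the receiver is the identity in one direction if and only if it
is in the other. This is `exists_precoders`; given the relays and the decoder, the precoders are the
transposes of left inverses of the broadcast transfer matrices, so that it suffices that these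
matrices are injective.

A broadcast code is found at random (`exists_broadcastCode`). Every symbol transmitted in the
reversed network is a uniformly random linear combination of what its node knows at that time.
Fix `w ≠ 0` and all the transmitted symbols `η`. If `a` is the number of symbols whose node knows
something nonzero, then these symbols are produced with probability at most `Q ^ (-a)`, where `Q`
is the size of the field (`card_coefficients_mul_le`). If some sender hears nothing, then the active
nodes form a cut whenever the set of active nodes does not change, and since the silent nodes have
heard nothing, `η` lies in the kernel of the transfer matrix of that cut, which has rank at least
`C` (`card_cut_kernel_mul_le`, `card_isSilentOutside_mul_le`). Summing over `η`, over the possible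
active regions and over `w` bounds the expected number of failures. These come in classes of `Q - 1`
scalar multiples, so that an expectation less than `Q - 1` is enough (`exists_coefficients`).

* Arbitrary networks, over `ZMod q` itself: relays use all that they have received in the past, so
  that a node that has become active remains active. Hence there are at most `(n + 1) ^ |V|` active
  regions, and at all but `|V|` of the `n` times a region pays the rank `C`. Messages of
  length `C * n - O(log n)` can be accommodated (`hasSumCode_causal`).
* Layered networks: signals pass each layer once, so that one use of the network over the field
  with `q ^ n` elements is enough, there are at most `2 ^ |V|` active regions, and the gain `Q - 1`
  from scalar multiples makes message length exactly `C` possible once `q ^ n > 2 ^ |V| + 1`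
  (`IsLayered.hasSumCode`). Restriction of scalars then gives a block code of length `n` for messages
  of length `n * C` over `ZMod q` (`IsLayered.blockTransformsInto`).
-/

open scoped Matrix Kronecker

namespace FFNetwork

/-! ### Linear algebra and duality -/

/-- An injective matrix over a field has a left inverse. -/
theorem exists_mul_eq_one_of_mulVec_injective {F X M : Type*} [Field F] [Fintype X] [Fintype M]
    [DecidableEq M] (A : Matrix X M F) (hA : ∀ w, A *ᵥ w = 0 → w = 0) :
    ∃ B : Matrix M X F, B * A = 1 := by
  classical
  obtain ⟨g, hg⟩ := LinearMap.exists_leftInverse_of_injective A.mulVecLin (by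
    rw [LinearMap.ker_eq_bot']
    exact hA)
  refine ⟨LinearMap.toMatrix' g, ?_⟩
  have h : A = LinearMap.toMatrix' A.mulVecLin := (LinearMap.toMatrix'_toLin' A).symm
  rw [h, ← LinearMap.toMatrix'_comp, hg, LinearMap.toMatrix'_id]

/-- The rank of a matrix does not drop under a field extension. -/
theorem rank_le_rank_map {F L X Y : Type*} [Field F] [Field L] [Algebra F L] [Fintype X]
    [Fintype Y] (A : Matrix Y X F) : A.rank ≤ (A.map (algebraMap F L)).rank := by
  classical
  -- `A` compresses to an identity matrix of size its rank, and this survives the base change.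
  have hfin : Module.finrank F (LinearMap.range A.mulVecLin) = A.rank := rfl
  let b := Module.finBasisOfFinrankEq F (LinearMap.range A.mulVecLin) hfin
  have hex : ∀ j, ∃ c : X → F, A *ᵥ c = (b j : Y → F) := fun j => (b j).2
  choose c hc using hex
  let C : Matrix X (Fin A.rank) F := Matrix.of fun x j => c j x
  have hAC : ∀ w, (A * C) *ᵥ w = ((∑ j, w j • b j : LinearMap.range A.mulVecLin) : Y → F) := by
    intro w
    have hcol : ∀ j y, (A * C) y j = (b j : Y → F) y := by
      intro j y
      rw [← hc j]
      simp [Matrix.mul_apply, Matrix.mulVec, dotProduct, C]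
    ext y
    push_cast
    simp only [Matrix.mulVec, dotProduct, hcol, Finset.sum_apply, Pi.smul_apply, smul_eq_mul]
    exact Finset.sum_congr rfl fun j _ => mul_comm _ _
  obtain ⟨B, hB⟩ := exists_mul_eq_one_of_mulVec_injective (A * C) (by
    intro w hw
    rw [hAC] at hw
    have h0 : ∑ j, w j • b j = 0 := Subtype.ext hw
    exact funext fun j => Fintype.linearIndependent_iff.1 b.linearIndependent w h0 j)
  have hmap := congrArg (fun M : Matrix _ _ F => M.map (algebraMap F L)) hB
  simp only [Matrix.map_mul] at hmap
  rw [Matrix.map_one _ (map_zero _) (map_one _)] at hmap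
  calc A.rank = (1 : Matrix (Fin A.rank) (Fin A.rank) L).rank := by simp
    _ ≤ (A.map (algebraMap F L) * C.map (algebraMap F L)).rank := by
        rw [← hmap]; exact Matrix.rank_mul_le_right _ _
    _ ≤ _ := Matrix.rank_mul_le_left _ _

/-- Duality. `R` is the matrix of the relays, `G` that of the channel, `D` the decoder, and sender
`i` controls the transmit coordinates in `J i`. If each sender can recover the vector `w` that the
receiver broadcasts over the transposed network, then precoders exist with which the receiver
obtains the sum of the messages: they are the transposes of the senders' recovery maps. -/
theorem exists_precoders {F X Y M ι : Type*} [Field F] [Fintype X] [Fintype Y]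
    [Fintype M] [Fintype ι] (G : Matrix Y X F) (R : Matrix X Y F) (D : Matrix M Y F)
    (J : ι → Set X) (hRG : ∀ x, x = R *ᵥ (G *ᵥ x) → x = 0)
    (hinj : ∀ i w ξ, ξ = Gᵀ *ᵥ (Dᵀ *ᵥ w + Rᵀ *ᵥ ξ) → (∀ c ∈ J i, ξ c = 0) → w = 0) :
    ∃ P : ι → Matrix X M F, (∀ i c, c ∉ J i → P i c = 0) ∧
      ∀ (x' : ι → M → F) x, x = ∑ i, P i *ᵥ x' i + R *ᵥ (G *ᵥ x) →
        D *ᵥ (G *ᵥ x) = ∑ i, x' i := by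
  classical
  let U : Matrix X X F := 1 - R * G
  have hU : IsUnit U := by
    rw [← Matrix.mulVec_injective_iff_isUnit]
    intro a b hab
    have h : U *ᵥ (a - b) = 0 := by
      rw [Matrix.mulVec_sub]; exact sub_eq_zero.2 hab
    refine sub_eq_zero.1 (hRG _ ?_)
    simpa [U, Matrix.sub_mulVec, sub_eq_zero] using h
  have hUd : IsUnit U.det := (Matrix.isUnit_iff_isUnit_det _).1 hU
  -- `T` is the transfer matrix of the broadcast: `T *ᵥ w` is received in the transposed network
  -- when the receiver broadcasts `w`.
  let T : Matrix X M F := (D * G * U⁻¹)ᵀ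
  have hT : Uᵀ * T = (D * G)ᵀ := by
    rw [← Matrix.transpose_mul, Matrix.mul_assoc, Matrix.nonsing_inv_mul _ hUd, Matrix.mul_one]
  let I (i : ι) : Matrix X X F := Matrix.diagonal fun c => if c ∈ J i then 1 else 0
  have hB : ∀ i, ∃ B : Matrix M X F, B * (I i * T) = 1 := by
    intro i
    refine exists_mul_eq_one_of_mulVec_injective _ fun w hw => ?_
    refine hinj i w (T *ᵥ w) ?_ ?_
    · have h := congrArg (· *ᵥ w) hT
      simp only [U, Matrix.transpose_sub, Matrix.transpose_one, Matrix.transpose_mul,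
        Matrix.sub_mul, Matrix.sub_mulVec, Matrix.one_mul, sub_eq_iff_eq_add] at h
      rwa [Matrix.mulVec_add, Matrix.mulVec_mulVec, Matrix.mulVec_mulVec, Matrix.mulVec_mulVec]
    · intro c hc
      have h := congrFun hw c
      rw [← Matrix.mulVec_mulVec] at h
      simpa [I, Matrix.mulVec_diagonal, hc] using h
  choose B hB using hB
  refine ⟨fun i => (B i * I i)ᵀ, ?_, ?_⟩
  · intro i c hc
    ext k
    simp [I, hc]
  · intro x' x hx
    have hUx : U *ᵥ x = ∑ i, (B i * I i)ᵀ *ᵥ x' i := by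
      rw [Matrix.sub_mulVec, Matrix.one_mulVec, ← Matrix.mulVec_mulVec, sub_eq_iff_eq_add]
      exact hx
    have hDG : D * G = Tᵀ * U := by
      rw [← Matrix.transpose_inj, ← hT, Matrix.transpose_mul, Matrix.transpose_transpose]
    rw [Matrix.mulVec_mulVec, hDG, ← Matrix.mulVec_mulVec, hUx, Matrix.mulVec_sum]
    refine Finset.sum_congr rfl fun i _ => ?_
    rw [Matrix.mulVec_mulVec, ← Matrix.transpose_mul, Matrix.mul_assoc, hB, Matrix.transpose_one,
      Matrix.one_mulVec]

/-- A linear system without feedback has exactly one run for each input. -/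
theorem existsUnique_eq_add_mulVec {F X Y : Type*} [Field F] [Fintype X] [Fintype Y]
    (G : Matrix Y X F) (R : Matrix X Y F) (hRG : ∀ x, x = R *ᵥ (G *ᵥ x) → x = 0) (p : X → F) :
    ∃! x, x = p + R *ᵥ (G *ᵥ x) := by
  let f : (X → F) →ₗ[F] (X → F) := LinearMap.id - R.mulVecLin ∘ₗ G.mulVecLin
  have hf : Function.Injective f := (injective_iff_map_eq_zero f).2 fun x hx =>
    hRG x (sub_eq_zero.1 hx)
  obtain ⟨x, hx⟩ := LinearMap.surjective_of_injective hf p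
  exact ⟨x, sub_eq_iff_eq_add.1 hx, fun y hy => hf ((sub_eq_iff_eq_add.2 hy).trans hx.symm)⟩

/-! ### Random linear coefficients -/

/-- For a uniformly random vector `a`, the value `a ⬝ z` is uniform if `z ≠ 0`, and is `0`
otherwise. -/
theorem card_dotProduct_eq_mul_card {F Z : Type*} [Field F] [Fintype F] [DecidableEq F] [Fintype Z]
    [DecidableEq Z] (z : Z → F) (hz : z ≠ 0) (c : F) :
    Fintype.card {a : Z → F // a ⬝ᵥ z = c} * Fintype.card F = Fintype.card (Z → F) := by
  classical
  obtain ⟨k, hk⟩ : ∃ k, z k ≠ 0 := by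
    by_contra! h
    exact hz (funext h)
  rw [← Fintype.card_prod]
  have hs : ∀ t : F, (Pi.single k (t / z k) : Z → F) ⬝ᵥ z = t := fun t => by
    rw [single_dotProduct, div_mul_cancel₀ _ hk]
  -- Shifting the `k`-th coordinate moves between the fibers of `a ↦ a ⬝ᵥ z`.
  refine Fintype.card_congr
    { toFun := fun p => p.1.1 + Pi.single k (p.2 / z k)
      invFun := fun a => (⟨a + Pi.single k ((c - a ⬝ᵥ z) / z k), ?_⟩, a ⬝ᵥ z - c)
      left_inv := ?_
      right_inv := ?_ }
  · rw [add_dotProduct, hs]; ring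
  · rintro ⟨⟨a, ha⟩, t⟩
    have h1 : (a + Pi.single k (t / z k)) ⬝ᵥ z = c + t := by rw [add_dotProduct, ha, hs]
    refine Prod.ext (Subtype.ext ?_) ?_
    · simp only [h1]
      rw [add_assoc, ← Pi.single_add, ← add_div]
      simp
    · simp only [h1]; ring
  · intro a
    simp only
    rw [add_assoc, ← Pi.single_add, ← add_div]
    simp

/-- The probability that random coefficient vectors `A y` produce the values `η y` from the
vectors `ζ y` is at most `Q ^ (-s)`, where `s` is the number of `y` with `ζ y ≠ 0`. -/
theorem card_coefficients_mul_le {F Y Z : Type*} [Field F] [Fintype F] [DecidableEq F] [Fintype Y]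
    [Fintype Z] [DecidableEq Y] [DecidableEq Z] (ζ : Y → Z → F) (η : Y → F) :
    Fintype.card {A : Y → Z → F // ∀ y, A y ⬝ᵥ ζ y = η y} *
      Fintype.card F ^ (Finset.univ.filter fun y => ζ y ≠ 0).card ≤
      Fintype.card (Y → Z → F) := by
  classical
  rw [Fintype.card_congr (Equiv.subtypePiEquivPi (p := fun y (a : Z → F) => a ⬝ᵥ ζ y = η y)),
    Fintype.card_pi, Fintype.card_pi, ← Finset.prod_const, Finset.prod_filter,
    ← Finset.prod_mul_distrib]
  refine Finset.prod_le_prod' fun y _ => ?_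
  split_ifs with h
  · exact (card_dotProduct_eq_mul_card _ h _).le
  · rw [mul_one]
    exact Fintype.card_subtype_le _

/-- Random coding with linear codes. `E` is a set of undesired events, closed under nonzero scalar
multiples; the event `e` happens for the coefficients `A` if `A y ⬝ ζ e y = η e y` for all `y`.
Since the events that happen come in classes of `Q - 1` scalar multiples, it suffices that their
expected number is less than `Q - 1`. -/
theorem exists_coefficients {F Y Z W : Type*} [Field F] [Fintype F] [Fintype Y] [Fintype Z]
    [DecidableEq Y] [DecidableEq Z] [AddCommGroup W] [Module F W] (ζ : W →ₗ[F] Y → Z → F)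
    (η : W →ₗ[F] Y → F) (E : Finset W) (hE0 : ∀ e ∈ E, e ≠ 0)
    (hE : ∀ c : F, c ≠ 0 → ∀ e ∈ E, c • e ∈ E)
    (hsum : ∑ e ∈ E, ((Fintype.card F : ℝ) ^ Nat.card {y // ζ e y ≠ 0})⁻¹ < Fintype.card F - 1) :
    ∃ A : Y → Z → F, ∀ e ∈ E, ¬ ∀ y, A y ⬝ᵥ ζ e y = η e y := by
  classical
  by_contra! hcon
  have hQ : (0 : ℝ) < Fintype.card F := by exact_mod_cast Fintype.card_pos
  let N : ℝ := Fintype.card (Y → Z → F)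
  have hN : 0 < N := Nat.cast_pos.2 Fintype.card_pos
  let run (A : Y → Z → F) (e : W) : Prop := ∀ y, A y ⬝ᵥ ζ e y = η e y
  have hlow : ∀ A, (Fintype.card F : ℝ) - 1 ≤ (E.filter (run A)).card := by
    intro A
    obtain ⟨e, he, hr⟩ := hcon A
    have hsub : (Finset.univ.filter fun c : F => c ≠ 0).image (fun c => c • e) ⊆
        E.filter (run A) := by
      intro e' he'
      obtain ⟨c, hc, rfl⟩ := Finset.mem_image.1 he'
      refine Finset.mem_filter.2 ⟨hE c (Finset.mem_filter.1 hc).2 e he, fun y => ?_⟩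
      simp [hr y]
    have hcard := Finset.card_le_card hsub
    rw [Finset.card_image_of_injective _ (smul_left_injective F (hE0 e he)),
      Finset.filter_ne', Finset.card_erase_of_mem (Finset.mem_univ _), Finset.card_univ] at hcard
    have : (Fintype.card F : ℝ) ≤ (E.filter (run A)).card + 1 := by
      exact_mod_cast Nat.sub_le_iff_le_add.1 hcard
    linarith
  have hcol : ∀ e ∈ E, ((Finset.univ.filter fun A => run A e).card : ℝ) ≤
      N * ((Fintype.card F : ℝ) ^ Nat.card {y // ζ e y ≠ 0})⁻¹ := by
    intro e he
    rw [le_mul_inv_iff₀ (pow_pos hQ _), Nat.card_eq_fintype_card, Fintype.card_subtype]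
    have h := card_coefficients_mul_le (ζ e) (η e)
    rw [Fintype.card_subtype] at h
    simp only [N, run]
    exact_mod_cast h
  have hdouble : ∑ A, ((E.filter (run A)).card : ℝ) =
      ∑ e ∈ E, ((Finset.univ.filter fun A => run A e).card : ℝ) := by
    simp only [Finset.card_filter, Nat.cast_sum]
    exact Finset.sum_comm
  have h1 : N * (Fintype.card F - 1) ≤ ∑ A, ((E.filter (run A)).card : ℝ) := by
    calc N * (Fintype.card F - 1) = ∑ _A : Y → Z → F, ((Fintype.card F : ℝ) - 1) := by
          rw [Finset.sum_const, Finset.card_univ, nsmul_eq_mul]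
      _ ≤ _ := Finset.sum_le_sum fun A _ => hlow A
  have h2 : ∑ e ∈ E, ((Finset.univ.filter fun A => run A e).card : ℝ) ≤
      N * ∑ e ∈ E, ((Fintype.card F : ℝ) ^ Nat.card {y // ζ e y ≠ 0})⁻¹ := by
    rw [Finset.mul_sum]
    exact Finset.sum_le_sum hcol
  have h3 := mul_lt_mul_of_pos_left hsum hN
  linarith

/-! ### Networks in matrix form -/

variable {q : ℕ} {V : Type*} {K : ℕ}

/-- The scalar symbols transmitted in the network in one channel use. -/
abbrev TxIndex (N : FFNetwork q V K) : Type _ := Σ v : V, Fin (N.α v)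

/-- The scalar symbols received in the network in one channel use. -/
abbrev RxIndex (N : FFNetwork q V K) : Type _ := Σ v : V, Fin (N.β v)

open Classical in
/-- The matrix of one channel use, from all transmitted to all received symbols, with entries in
an extension `F` of `ZMod q`. -/
noncomputable def channelMatrix (N : FFNetwork q V K) (F : Type*) [CommRing F]
    [Algebra (ZMod q) F] : Matrix N.RxIndex N.TxIndex F :=
  Matrix.of fun y x =>
    if N.graph.Adj x.1 y.1 then algebraMap (ZMod q) F (N.h x.1 y.1 y.2 x.2) else 0

open Classical in
/-- The matrix of the channel uses at the times in `T`. -/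
noncomputable def timedChannelMatrix (N : FFNetwork q V K) (F : Type*) [CommRing F]
    [Algebra (ZMod q) F] (T : Type*) : Matrix (N.RxIndex × T) (N.TxIndex × T) F :=
  N.channelMatrix F ⊗ₖ (1 : Matrix T T F)

theorem timedChannelMatrix_mulVec [Fintype V] (N : FFNetwork q V K) {F : Type*} [CommRing F]
    [Algebra (ZMod q) F] {T : Type*} [Fintype T] (x : N.TxIndex × T → F) (y : N.RxIndex × T) :
    (N.timedChannelMatrix F T *ᵥ x) y = (N.channelMatrix F *ᵥ fun u => x (u, y.2)) y.1 := by
  classical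
  simp [timedChannelMatrix, Matrix.mulVec, dotProduct, Fintype.sum_prod_type,
    Matrix.kroneckerMap_apply, Matrix.one_apply]

theorem timedChannelMatrix_transpose_mulVec [Fintype V] (N : FFNetwork q V K) {F : Type*}
    [CommRing F] [Algebra (ZMod q) F] {T : Type*} [Fintype T] (η : N.RxIndex × T → F)
    (x : N.TxIndex × T) :
    ((N.timedChannelMatrix F T)ᵀ *ᵥ η) x =
      ((N.channelMatrix F)ᵀ *ᵥ fun v => η (v, x.2)) x.1 := by
  classical
  simp [timedChannelMatrix, Matrix.mulVec, dotProduct, Fintype.sum_prod_type,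
    Matrix.kroneckerMap_apply, Matrix.one_apply]

/-- The matrix `R` combines, at each node other than the receiver, the symbols received at time
`s` into those transmitted at time `t` only if `rel s t`. -/
def IsRelayMatrix (N : FFNetwork q V K) {F T : Type*} [Zero F] (rel : T → T → Prop)
    (R : Matrix (N.TxIndex × T) (N.RxIndex × T) F) : Prop :=
  ∀ x y, R x y ≠ 0 → x.1.1 = y.1.1 ∧ rel y.2 x.2 ∧ y.1.1 ≠ N.receiver

/-- If signals advance along a height function then the network has no feedback: without
messages, nothing is transmitted. -/
theorem IsRelayMatrix.eq_zero [Fintype V] {N : FFNetwork q V K} {F T : Type*} [Field F]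
    [Algebra (ZMod q) F] [Fintype T] {rel : T → T → Prop}
    {R : Matrix (N.TxIndex × T) (N.RxIndex × T) F} (hR : N.IsRelayMatrix rel R)
    (ρ : V → T → ℕ) (hρ : ∀ u v s t, N.graph.Adj u v → rel s t → ρ u s < ρ v t)
    (x : N.TxIndex × T → F) (hx : x = R *ᵥ (N.timedChannelMatrix F T *ᵥ x)) : x = 0 := by
  have key : ∀ k, ∀ z : N.TxIndex × T, ρ z.1.1 z.2 = k → x z = 0 := by
    intro k
    induction k using Nat.strong_induction_on with
    | _ k ih =>
      intro z hz
      rw [hx]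
      refine Finset.sum_eq_zero fun y _ => ?_
      by_cases hRzy : R z y = 0
      · exact mul_eq_zero_of_left hRzy _
      obtain ⟨h1, h2, -⟩ := hR z y hRzy
      rw [timedChannelMatrix_mulVec]
      refine mul_eq_zero_of_right _ (Finset.sum_eq_zero fun u _ => ?_)
      by_cases hadj : N.graph.Adj u.1 y.1.1
      · refine mul_eq_zero_of_right _ (ih _ ?_ (u, y.2) rfl)
        rw [← hz]
        exact hρ _ _ _ _ (h1 ▸ hadj) h2
      · simp [channelMatrix, hadj]
  exact funext fun z => key _ z rfl

/-- There are precoders `P`, relays `R` and a decoder `D` over `F`, of the shape prescribed by the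
network and by `rel`, with which the receiver obtains the sum of the messages. -/
def HasSumCode [Fintype V] (N : FFNetwork q V K) (F : Type*) [Field F] [Algebra (ZMod q) F]
    {T : Type*} [Fintype T] (rel : T → T → Prop) (m : ℕ) : Prop :=
  ∃ (P : Fin K → Matrix (N.TxIndex × T) (Fin m) F) (R : Matrix (N.TxIndex × T) (N.RxIndex × T) F)
    (D : Matrix (Fin m) (N.RxIndex × T) F),
    (∀ i x, x.1.1 ≠ N.sender i → P i x = 0) ∧ N.IsRelayMatrix rel R ∧
    (∀ k y, y.1.1 ≠ N.receiver → D k y = 0) ∧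
    ∀ (x' : Fin K → Fin m → F) x,
      x = ∑ i, P i *ᵥ x' i + R *ᵥ (N.timedChannelMatrix F T *ᵥ x) →
        D *ᵥ (N.timedChannelMatrix F T *ᵥ x) = ∑ i, x' i

/-! ### Cuts of the transposed network -/

open Classical in
theorem capacity_le_rank [Fintype V] (N : FFNetwork q V K) (i : Fin K) (Ω : Finset V)
    (hΩ : Ω ∈ N.cuts i) : N.capacity ≤ (N.transferMatrix i Ω).rank :=
  (ciInf_le (OrderBot.bddBelow _) i).trans
    (ciInf_le (OrderBot.bddBelow (Set.range fun Ω : N.cuts i => (N.transferMatrix i Ω).rank))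
      ⟨Ω, hΩ⟩)

open Classical in
/-- A cut of the whole network has at least the rank of its restriction to the nodes that can be
reached from sender `i`; over the transposed network this bounds the number of transmissions of
`S` that no node outside `S` notices. -/
theorem card_cut_kernel_mul_le [Fact q.Prime] [Fintype V] (N : FFNetwork q V K) (F : Type*)
    [Field F] [Fintype F] [Algebra (ZMod q) F] (i : Fin K) (S : Set V) (hd : N.receiver ∈ S)
    (hi : N.sender i ∉ S) :
    Nat.card {η : N.RxIndex → F // (∀ y, y.1 ∉ S → η y = 0) ∧
      ∀ x : N.TxIndex, x.1 ∉ S → ((N.channelMatrix F)ᵀ *ᵥ η) x = 0} *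
        Fintype.card F ^ N.capacity ≤ Fintype.card F ^ Nat.card {y : N.RxIndex // y.1 ∈ S} := by
  let B : Matrix {x : N.TxIndex // x.1 ∉ S} {y : N.RxIndex // y.1 ∈ S} F :=
    (N.channelMatrix F)ᵀ.submatrix Subtype.val Subtype.val
  have hrank : N.capacity ≤ B.rank := by
    let Ω : Finset V := (N.reach i \ S).toFinset
    have hΩ : Ω ∈ N.cuts i :=
      ⟨by simp [Ω], Set.mem_toFinset.2 ⟨Relation.ReflTransGen.refl, hi⟩, by simp [Ω, hd]⟩
    have hmap : ((N.transferMatrix i Ω).map (algebraMap (ZMod q) F))ᵀ = B.submatrix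
        (fun c => ⟨⟨c.1.1, c.2⟩, (Set.mem_toFinset.1 c.1.2).2⟩)
        (fun r => ⟨⟨r.1.1, r.2⟩, by
          by_contra h
          exact r.1.2.2 (Set.mem_toFinset.2 ⟨r.1.2.1, h⟩)⟩) := by
      ext c r
      simp only [B, transferMatrix, channelMatrix, Matrix.transpose_apply, Matrix.map_apply,
        Matrix.submatrix_apply, Matrix.of_apply]
      split_ifs <;> simp
    calc N.capacity ≤ (N.transferMatrix i Ω).rank := N.capacity_le_rank i Ω hΩ
      _ ≤ ((N.transferMatrix i Ω).map (algebraMap (ZMod q) F)).rank := rank_le_rank_map _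
      _ = ((N.transferMatrix i Ω).map (algebraMap (ZMod q) F))ᵀ.rank :=
          (Matrix.rank_transpose _).symm
      _ ≤ B.rank := by rw [hmap]; exact Matrix.rank_submatrix_le _ _ _
  have hker : Nat.card (LinearMap.ker B.mulVecLin) * Fintype.card F ^ B.rank =
      Fintype.card F ^ Nat.card {y : N.RxIndex // y.1 ∈ S} := by
    rw [Nat.card_eq_fintype_card, Module.card_eq_pow_finrank (K := F), ← pow_add]
    have := LinearMap.finrank_range_add_finrank_ker B.mulVecLin
    rw [Module.finrank_fintype_fun_eq_card] at this
    rw [add_comm, Nat.card_eq_fintype_card, ← this]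
    rfl
  rw [← hker]
  refine Nat.mul_le_mul ?_ (Nat.pow_le_pow_right Fintype.card_pos hrank)
  refine Nat.card_le_card_of_injective
    (fun η => (⟨fun y => η.1 y.1, ?_⟩ : LinearMap.ker B.mulVecLin)) ?_
  · rw [LinearMap.mem_ker, Matrix.mulVecLin_apply]
    ext x
    refine Eq.trans ?_ (η.2.2 x.1 x.2)
    simp only [B, Matrix.mulVec, dotProduct, Matrix.submatrix_apply]
    rw [← Finset.sum_subtype (Finset.univ.filter fun y : N.RxIndex => y.1 ∈ S) (by simp)
      (fun y => (N.channelMatrix F)ᵀ x.1 y * η.1 y), Finset.sum_filter]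
    refine Finset.sum_congr rfl fun y _ => ?_
    split_ifs with h
    · rfl
    · rw [η.2.1 y h, mul_zero]
  · intro η η' h
    refine Subtype.ext (funext fun y => ?_)
    by_cases hy : y.1 ∈ S
    · exact congrFun (Subtype.ext_iff.1 h) ⟨y, hy⟩
    · rw [η.2.1 y hy, η'.2.1 y hy]

/-- The signals `η` on the transposed network vanish outside the space-time region `S`, and a node
that is outside `S` at time `s` hears nothing on which its transmission at time `s` may depend. -/
def IsSilentOutside [Fintype V] (N : FFNetwork q V K) {F : Type*} [Field F]
    [Algebra (ZMod q) F] {T : Type*} [Fintype T] (rel : T → T → Prop) (S : Set (V × T))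
    (η : N.RxIndex × T → F) : Prop :=
  (∀ y, (y.1.1, y.2) ∉ S → η y = 0) ∧
    ∀ x s, rel s x.2 → (x.1.1, s) ∉ S → ((N.timedChannelMatrix F T)ᵀ *ᵥ η) x = 0

/-- Suppose that each node outside `S` at a time `t` in `good` is also outside `S` at some time `s` at
which its transmission may depend on what it hears at time `t`. Then it hears nothing at time `t`,
and the signals at time `t` lie in the kernel of a transfer matrix of a cut. -/
theorem card_isSilentOutside_mul_le [Fact q.Prime] [Fintype V] (N : FFNetwork q V K) (F : Type*)
    [Field F] [Fintype F] [Algebra (ZMod q) F] {T : Type*} [Fintype T] (rel : T → T → Prop)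
    (i : Fin K) (S : Set (V × T)) (hd : ∀ t, (N.receiver, t) ∈ S) (hi : ∀ t, (N.sender i, t) ∉ S)
    (good : Finset T) (hgood : ∀ t ∈ good, ∀ u, (u, t) ∉ S → ∃ s, rel s t ∧ (u, s) ∉ S) :
    Nat.card {η : N.RxIndex × T → F // N.IsSilentOutside rel S η} *
        Fintype.card F ^ (N.capacity * good.card) ≤
      Fintype.card F ^ Nat.card {y : N.RxIndex × T // (y.1.1, y.2) ∈ S} := by
  classical
  -- The constraints are weakened to ones that refer to a single time, so that the count factors.
  let slice (t : T) : Type _ := {η : N.RxIndex → F // (∀ y, (y.1, t) ∉ S → η y = 0) ∧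
    (t ∈ good → ∀ x : N.TxIndex, (x.1, t) ∉ S → ((N.channelMatrix F)ᵀ *ᵥ η) x = 0)}
  have hslice : ∀ t, Nat.card (slice t) * Fintype.card F ^ (if t ∈ good then N.capacity else 0) ≤
      Fintype.card F ^ Nat.card {y : N.RxIndex // (y.1, t) ∈ S} := by
    intro t
    by_cases ht : t ∈ good
    · rw [if_pos ht]
      refine le_trans (Nat.mul_le_mul_right _ (le_of_eq ?_))
        (N.card_cut_kernel_mul_le F i {v | (v, t) ∈ S} (hd t) (hi t))
      exact Nat.card_congr (Equiv.subtypeEquivRight fun η => by simp [ht])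
    · rw [if_neg ht, pow_zero, mul_one]
      calc Nat.card (slice t) ≤ Nat.card ({y : N.RxIndex // (y.1, t) ∈ S} → F) := by
            refine Nat.card_le_card_of_injective (fun η y => η.1 y.1) fun η η' h => ?_
            refine Subtype.ext (funext fun y => ?_)
            by_cases hy : (y.1, t) ∈ S
            · exact congrFun h ⟨y, hy⟩
            · rw [η.2.1 y hy, η'.2.1 y hy]
        _ = _ := by rw [Nat.card_fun, Nat.card_eq_fintype_card (α := F)]
  have hinj : Nat.card {η : N.RxIndex × T → F // N.IsSilentOutside rel S η} ≤
      ∏ t, Nat.card (slice t) := by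
    rw [← Nat.card_pi]
    refine Nat.card_le_card_of_injective
      (fun η t => (⟨fun y => η.1 (y, t), fun y hy => η.2.1 (y, t) hy, fun ht x hx => ?_⟩ : slice t))
      fun η η' h => ?_
    · obtain ⟨s, hs, hxs⟩ := hgood t ht x.1 hx
      rw [← η.2.2 (x, t) s hs hxs, timedChannelMatrix_transpose_mulVec]
    · exact Subtype.ext (funext fun y => congrFun (Subtype.ext_iff.1 (congrFun h y.2)) y.1)
  have hsize : Nat.card {y : N.RxIndex × T // (y.1.1, y.2) ∈ S} =
      ∑ t, Nat.card {y : N.RxIndex // (y.1, t) ∈ S} := by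
    rw [← Nat.card_sigma]
    exact Nat.card_congr
      { toFun := fun y => ⟨y.1.2, y.1.1, y.2⟩
        invFun := fun y => ⟨(y.2.1, y.1), y.2.2⟩
        left_inv := fun _ => rfl
        right_inv := fun _ => rfl }
  have hexp : N.capacity * good.card = ∑ t, if t ∈ good then N.capacity else 0 := by
    rw [← Finset.sum_filter, Finset.filter_mem_eq_inter, Finset.univ_inter, Finset.sum_const,
      smul_eq_mul, mul_comm]
  rw [hsize, hexp, ← Finset.prod_pow_eq_pow_sum, ← Finset.prod_pow_eq_pow_sum]
  refine (Nat.mul_le_mul_right _ hinj).trans ?_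
  rw [← Finset.prod_mul_distrib]
  exact Finset.prod_le_prod' fun t _ => hslice t

/-! ### Random broadcast over the transposed network -/

open Classical in
/-- What the transmitted symbol `y` may depend on in the transposed network when the receiver
broadcasts `e.1` and the transmitted symbols are `e.2`: at the receiver, the broadcast vector; at
another node, the symbols that it has received, as far as `rel` permits. -/
noncomputable def knowledge [Fintype V] (N : FFNetwork q V K) (F : Type*) [Field F]
    [Algebra (ZMod q) F] {T : Type*} [Fintype T] (rel : T → T → Prop) (m : ℕ) :
    ((Fin m → F) × (N.RxIndex × T → F)) →ₗ[F]
      (N.RxIndex × T → (N.TxIndex × T) ⊕ Fin m → F) where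
  toFun e y := Sum.elim
    (fun x => if x.1.1 = y.1.1 ∧ rel y.2 x.2 ∧ y.1.1 ≠ N.receiver then
      ((N.timedChannelMatrix F T)ᵀ *ᵥ e.2) x else 0)
    (fun k => if y.1.1 = N.receiver then e.1 k else 0)
  map_add' e e' := by
    ext y (x | k)
    · simp only [Sum.elim_inl, Prod.snd_add, Matrix.mulVec_add, Pi.add_apply]
      split_ifs <;> simp
    · simp only [Sum.elim_inr, Prod.fst_add, Pi.add_apply]
      split_ifs <;> simp
  map_smul' c e := by
    ext y (x | k)
    · simp only [Sum.elim_inl, Prod.smul_snd, Matrix.mulVec_smul, Pi.smul_apply,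
        RingHom.id_apply]
      split_ifs <;> simp
    · simp only [Sum.elim_inr, Prod.smul_fst, Pi.smul_apply, RingHom.id_apply]
      split_ifs <;> simp

/-- The space-time region in which a node has something to transmit in the transposed network:
the receiver at all times, and another node once it has heard something nonzero. -/
def activeRegion [Fintype V] (N : FFNetwork q V K) {F : Type*} [Field F] [Algebra (ZMod q) F]
    {T : Type*} [Fintype T] (rel : T → T → Prop) (η : N.RxIndex × T → F) : Set (V × T) :=
  {p | p.1 = N.receiver ∨ ∃ x : N.TxIndex × T, x.1.1 = p.1 ∧ rel p.2 x.2 ∧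
    ((N.timedChannelMatrix F T)ᵀ *ᵥ η) x ≠ 0}

theorem knowledge_ne_zero_iff [Fintype V] (N : FFNetwork q V K) {F : Type*} [Field F]
    [Algebra (ZMod q) F] {T : Type*} [Fintype T] (rel : T → T → Prop) {m : ℕ}
    (e : (Fin m → F) × (N.RxIndex × T → F)) (he : e.1 ≠ 0) (y : N.RxIndex × T) :
    N.knowledge F rel m e y ≠ 0 ↔ (y.1.1, y.2) ∈ N.activeRegion rel e.2 := by
  classical
  constructor
  · intro h
    obtain ⟨z, hz⟩ := Function.ne_iff.1 h
    rcases z with x | k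
    · simp only [knowledge, LinearMap.coe_mk, AddHom.coe_mk, Sum.elim_inl, Pi.zero_apply, ne_eq,
        ite_eq_right_iff, Classical.not_imp] at hz
      exact Or.inr ⟨x, hz.1.1, hz.1.2.1, hz.2⟩
    · simp only [knowledge, LinearMap.coe_mk, AddHom.coe_mk, Sum.elim_inr, Pi.zero_apply, ne_eq,
        ite_eq_right_iff, Classical.not_imp] at hz
      exact Or.inl hz.1
  · intro h h0
    by_cases hy : y.1.1 = N.receiver
    · refine he (funext fun k => ?_)
      have := congrFun h0 (Sum.inr k)
      simpa [knowledge, hy] using this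
    · obtain ⟨x, hx1, hx2, hx3⟩ := h.resolve_left hy
      have := congrFun h0 (Sum.inl x)
      simp only [knowledge, LinearMap.coe_mk, AddHom.coe_mk, Sum.elim_inl] at this
      rw [if_pos ⟨hx1, hx2, hy⟩] at this
      exact hx3 this

/-- A random linear broadcast code from the receiver over the transposed network. An undesired
event is a vector `w ≠ 0` with the resulting transmissions `η`, such that some sender hears
nothing. Its probability is `Q ^ (-a)`, where `a` is the number of symbols transmitted in the
active region of `η`; and for a given region there are at most `Q ^ (m + a - r)` such events. The
hypothesis `hcount` bounds the expected number of events. -/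
theorem exists_broadcastCode [Fintype V] (N : FFNetwork q V K) (F : Type*) [Field F] [Fintype F]
    [Algebra (ZMod q) F] {T : Type*} [Fintype T] (rel : T → T → Prop)
    (𝓢 : Finset (Set (V × T))) (h𝓢 : ∀ η : N.RxIndex × T → F, N.activeRegion rel η ∈ 𝓢) (r m : ℕ)
    (hr : ∀ i, ∀ S ∈ 𝓢, (∀ t, (N.receiver, t) ∈ S) → (∀ t, (N.sender i, t) ∉ S) →
      Nat.card {η : N.RxIndex × T → F // N.IsSilentOutside rel S η} * Fintype.card F ^ r ≤
        Fintype.card F ^ Nat.card {y : N.RxIndex × T // (y.1.1, y.2) ∈ S})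
    (hcount : (𝓢.card : ℝ) * (Fintype.card F : ℝ) ^ m <
      (Fintype.card F - 1) * (Fintype.card F : ℝ) ^ r) :
    ∃ A : N.RxIndex × T → (N.TxIndex × T) ⊕ Fin m → F,
      ∀ i w η, (∀ y, A y ⬝ᵥ N.knowledge F rel m (w, η) y = η y) →
        (∀ x : N.TxIndex × T, x.1.1 = N.sender i → ((N.timedChannelMatrix F T)ᵀ *ᵥ η) x = 0) →
        w = 0 := by
  classical
  have hQ : (0 : ℝ) < Fintype.card F := Nat.cast_pos.2 Fintype.card_pos
  let silent (η : N.RxIndex × T → F) : Prop := ∃ i, ∀ x : N.TxIndex × T, x.1.1 = N.sender i →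
    ((N.timedChannelMatrix F T)ᵀ *ᵥ η) x = 0
  -- The last condition holds for whatever a code can produce: who knows nothing transmits zero.
  let E : Finset ((Fin m → F) × (N.RxIndex × T → F)) := Finset.univ.filter fun e =>
    e.1 ≠ 0 ∧ silent e.2 ∧ ∀ y, N.knowledge F rel m e y = 0 → e.2 y = 0
  let 𝓢' := 𝓢.filter fun S => ∃ i, (∀ t, (N.receiver, t) ∈ S) ∧ ∀ t, (N.sender i, t) ∉ S
  let events (S : Set (V × T)) : Finset ((Fin m → F) × (N.RxIndex × T → F)) :=
    Finset.univ ×ˢ Finset.univ.filter fun η => N.IsSilentOutside rel S η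
  let size (S : Set (V × T)) : ℕ := Nat.card {y : N.RxIndex × T // (y.1.1, y.2) ∈ S}
  have hE : ∀ e ∈ E, N.activeRegion rel e.2 ∈ 𝓢' ∧ e ∈ events (N.activeRegion rel e.2) ∧
      Nat.card {y // N.knowledge F rel m e y ≠ 0} = size (N.activeRegion rel e.2) := by
    intro e he
    obtain ⟨hw, ⟨i, hi⟩, hη⟩ := (Finset.mem_filter.1 he).2
    refine ⟨Finset.mem_filter.2 ⟨h𝓢 _, i, fun t => Or.inl rfl, fun t ht => ?_⟩, ?_, ?_⟩
    · obtain ⟨x, hx1, -, hx3⟩ := ht.resolve_left (N.sender_ne_receiver i)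
      exact hx3 (hi x hx1)
    · refine Finset.mem_product.2 ⟨Finset.mem_univ _, Finset.mem_filter.2 ⟨Finset.mem_univ _,
        fun y hy => hη y ?_, fun x s hs hx => ?_⟩⟩
      · by_contra h
        exact hy ((N.knowledge_ne_zero_iff rel e hw y).1 h)
      · by_contra h
        exact hx (Or.inr ⟨x, rfl, hs, h⟩)
    · exact Nat.card_congr (Equiv.subtypeEquivRight (N.knowledge_ne_zero_iff rel e hw))
  have hevents : ∀ S ∈ 𝓢', ((events S).card : ℝ) * ((Fintype.card F : ℝ) ^ size S)⁻¹ ≤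
      (Fintype.card F : ℝ) ^ m / (Fintype.card F : ℝ) ^ r := by
    intro S hS
    obtain ⟨hS, i, h1, h2⟩ := Finset.mem_filter.1 hS
    have h := hr i S hS h1 h2
    rw [Nat.card_eq_fintype_card, Fintype.card_subtype] at h
    have h' : ((Finset.univ.filter fun η : N.RxIndex × T → F =>
        N.IsSilentOutside rel S η).card : ℝ) * (Fintype.card F : ℝ) ^ r ≤
        (Fintype.card F : ℝ) ^ size S := by exact_mod_cast h
    have hcard : ((events S).card : ℝ) = (Fintype.card F : ℝ) ^ m *
        (Finset.univ.filter fun η : N.RxIndex × T → F => N.IsSilentOutside rel S η).card := by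
      rw [Finset.card_product]
      simp
    rw [hcard, ← div_eq_mul_inv, div_le_div_iff₀ (pow_pos hQ _) (pow_pos hQ _), mul_assoc]
    exact mul_le_mul_of_nonneg_left h' (pow_pos hQ _).le
  have hE0 : ∀ e ∈ E, e ≠ 0 := by
    intro e he h0
    exact (Finset.mem_filter.1 he).2.1 (by rw [h0]; rfl)
  have hEsmul : ∀ c : F, c ≠ 0 → ∀ e ∈ E, c • e ∈ E := by
    intro c hc e he
    obtain ⟨hw, ⟨i, hi⟩, hη⟩ := (Finset.mem_filter.1 he).2
    refine Finset.mem_filter.2 ⟨Finset.mem_univ _, smul_ne_zero hc hw, ⟨i, fun x hx => ?_⟩,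
      fun y hy => ?_⟩
    · rw [Prod.smul_snd, Matrix.mulVec_smul, Pi.smul_apply, hi x hx, smul_zero]
    · rw [map_smul, Pi.smul_apply, smul_eq_zero_iff_right hc] at hy
      rw [Prod.smul_snd, Pi.smul_apply, hη y hy, smul_zero]
  have hsum : ∑ e ∈ E, ((Fintype.card F : ℝ) ^ Nat.card {y // N.knowledge F rel m e y ≠ 0})⁻¹ <
      Fintype.card F - 1 := by
    calc ∑ e ∈ E, ((Fintype.card F : ℝ) ^ Nat.card {y // N.knowledge F rel m e y ≠ 0})⁻¹
        ≤ ∑ e ∈ E, ∑ S ∈ 𝓢', if e ∈ events S then ((Fintype.card F : ℝ) ^ size S)⁻¹ else 0 := by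
          refine Finset.sum_le_sum fun e he => ?_
          obtain ⟨h1, h2, h3⟩ := hE e he
          rw [h3]
          refine le_trans ?_ (Finset.single_le_sum (fun S _ => ?_) h1)
          · rw [if_pos h2]
          · split_ifs <;> positivity
      _ = ∑ S ∈ 𝓢', ∑ e ∈ E, if e ∈ events S then ((Fintype.card F : ℝ) ^ size S)⁻¹ else 0 :=
          Finset.sum_comm
      _ ≤ ∑ S ∈ 𝓢', (Fintype.card F : ℝ) ^ m / (Fintype.card F : ℝ) ^ r := by
          refine Finset.sum_le_sum fun S hS => le_trans ?_ (hevents S hS)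
          rw [← Finset.sum_filter, Finset.sum_const, nsmul_eq_mul]
          refine mul_le_mul_of_nonneg_right ?_ (by positivity)
          exact_mod_cast Finset.card_le_card fun e he => (Finset.mem_filter.1 he).2
      _ ≤ 𝓢.card * ((Fintype.card F : ℝ) ^ m / (Fintype.card F : ℝ) ^ r) := by
          rw [Finset.sum_const, nsmul_eq_mul]
          refine mul_le_mul_of_nonneg_right ?_ (by positivity)
          exact_mod_cast Finset.card_filter_le _ _
      _ < Fintype.card F - 1 := by
          rw [← mul_div_assoc, div_lt_iff₀ (pow_pos hQ _)]
          exact hcount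
  obtain ⟨A, hA⟩ := exists_coefficients (N.knowledge F rel m) (LinearMap.snd F _ _) E hE0 hEsmul hsum
  refine ⟨A, fun i w η hrun hi => ?_⟩
  by_contra hw
  refine hA (w, η) (Finset.mem_filter.2 ⟨Finset.mem_univ _, hw, ⟨i, hi⟩, fun y hy => ?_⟩) hrun
  have := hrun y
  rw [hy, dotProduct_zero] at this
  exact this.symm

/-- The transposes of a broadcast code are a code for the sum of the messages. -/
theorem hasSumCode_of_card_lt [Fintype V] (N : FFNetwork q V K) (F : Type*) [Field F] [Fintype F]
    [Algebra (ZMod q) F] {T : Type*} [Fintype T] (rel : T → T → Prop)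
    (ρ : V → T → ℕ) (hρ : ∀ u v s t, N.graph.Adj u v → rel s t → ρ u s < ρ v t)
    (𝓢 : Finset (Set (V × T))) (h𝓢 : ∀ η : N.RxIndex × T → F, N.activeRegion rel η ∈ 𝓢) (r m : ℕ)
    (hr : ∀ i, ∀ S ∈ 𝓢, (∀ t, (N.receiver, t) ∈ S) → (∀ t, (N.sender i, t) ∉ S) →
      Nat.card {η : N.RxIndex × T → F // N.IsSilentOutside rel S η} * Fintype.card F ^ r ≤
        Fintype.card F ^ Nat.card {y : N.RxIndex × T // (y.1.1, y.2) ∈ S})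
    (hcount : (𝓢.card : ℝ) * (Fintype.card F : ℝ) ^ m <
      (Fintype.card F - 1) * (Fintype.card F : ℝ) ^ r) :
    N.HasSumCode F rel m := by
  classical
  obtain ⟨A, hA⟩ := N.exists_broadcastCode F rel 𝓢 h𝓢 r m hr hcount
  let R : Matrix (N.TxIndex × T) (N.RxIndex × T) F := Matrix.of fun x y =>
    if x.1.1 = y.1.1 ∧ rel y.2 x.2 ∧ y.1.1 ≠ N.receiver then A y (Sum.inl x) else 0
  let D : Matrix (Fin m) (N.RxIndex × T) F := Matrix.of fun k y =>
    if y.1.1 = N.receiver then A y (Sum.inr k) else 0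
  have hR : N.IsRelayMatrix rel R := by
    intro x y h
    by_contra hn
    exact h (if_neg hn)
  obtain ⟨P, hP, hPD⟩ := exists_precoders (N.timedChannelMatrix F T) R D
    (fun i => {x | x.1.1 = N.sender i}) (hR.eq_zero ρ hρ) (by
      intro i w ξ hξ hi
      refine hA i w (Dᵀ *ᵥ w + Rᵀ *ᵥ ξ) (fun y => ?_) (by rw [← hξ]; exact hi)
      simp only [knowledge, LinearMap.coe_mk, AddHom.coe_mk, ← hξ]
      rw [dotProduct, Fintype.sum_sum_type, add_comm]
      simp only [Sum.elim_inl, Sum.elim_inr, Pi.add_apply, Matrix.mulVec, dotProduct,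
        Matrix.transpose_apply, R, D, Matrix.of_apply, mul_ite, ite_mul, mul_zero, zero_mul])
  exact ⟨P, R, D, hP, hR, fun k y hy => if_neg hy, hPD⟩

/-! ### Arbitrary networks -/

theorem channelMatrix_mulVec [Fintype V] (N : FFNetwork q V K)
    (x : ∀ u : V, Fin (N.α u) → ZMod q) (y : N.RxIndex) :
    (N.channelMatrix (ZMod q) *ᵥ fun u => x u.1 u.2) y = N.channel x y.1 y.2 := by
  classical
  simp only [channelMatrix, Matrix.mulVec, dotProduct, channel, Fintype.sum_sigma,
    Finset.sum_filter, Finset.sum_apply, Matrix.of_apply]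
  refine Finset.sum_congr rfl fun u _ => ?_
  split_ifs
  · rfl
  · simp

/-- The transposed network runs backwards in time: a node is active before the last time at which
it hears something, so that at most `(n + 1) ^ |V|` active regions occur; and a region changes at
no more than `|V|` times. -/
theorem hasSumCode_causal [Fact q.Prime] [Fintype V] (N : FFNetwork q V K) (n m : ℕ)
    (h : (n + 1) ^ Fintype.card V * q ^ m < q ^ (N.capacity * (n - Fintype.card V))) :
    N.HasSumCode (ZMod q) (fun s t : Fin n => s < t) m := by
  classical
  -- Node `v` is active before time `τ v`; `τ v = 0` if it never hears anything.
  let region (τ : V → Fin (n + 1)) : Set (V × Fin n) :=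
    {p | p.1 = N.receiver ∨ (p.2 : ℕ) < τ p.1}
  have hq2 : 2 ≤ q := (Fact.out : q.Prime).two_le
  refine N.hasSumCode_of_card_lt (ZMod q) (T := Fin n) _ (fun _ t => (t : ℕ))
    (fun _ _ _ _ _ hst => hst) (Finset.univ.image region) ?_ (N.capacity * (n - Fintype.card V)) m ?_ ?_
  · intro η
    let heard (v : V) : Finset (N.TxIndex × Fin n) := Finset.univ.filter fun x =>
      x.1.1 = v ∧ ((N.timedChannelMatrix (ZMod q) (Fin n))ᵀ *ᵥ η) x ≠ 0
    let last (v : V) : ℕ := (heard v).sup fun x => (x.2 : ℕ)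
    have hlast : ∀ v, last v < n + 1 := fun v =>
      Nat.lt_succ_of_le (Finset.sup_le fun x _ => x.2.2.le)
    refine Finset.mem_image.2 ⟨fun v => ⟨last v, hlast v⟩, Finset.mem_univ _, ?_⟩
    ext ⟨v, s⟩
    simp only [region, activeRegion, Set.mem_ofPred_eq, last, Finset.lt_sup_iff, heard,
      Finset.mem_filter, Finset.mem_univ, true_and]
    refine or_congr_right (exists_congr fun x => ?_)
    tauto
  · intro i S hS hd hi
    obtain ⟨τ, -, rfl⟩ := Finset.mem_image.1 hS
    -- An inactive node `u` at a good time `t` has `τ u < t`, so that what it heard at time `t` would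
    -- have made it active at time `τ u`.
    let good : Finset (Fin n) := Finset.univ.filter fun t => ∀ v, (τ v : ℕ) ≠ t
    have hcard : n - Fintype.card V ≤ good.card := by
      have hbad : (Finset.univ.filter fun t : Fin n => ¬ ∀ v, (τ v : ℕ) ≠ t).card ≤
          Fintype.card V := by
        rw [← Finset.card_map Fin.valEmbedding]
        refine (Finset.card_le_card ?_).trans
          (Finset.card_image_le (s := Finset.univ) (f := fun v => (τ v : ℕ)))
        intro k hk
        obtain ⟨t, ht, rfl⟩ := Finset.mem_map.1 hk
        obtain ⟨v, hv⟩ := not_forall.1 (Finset.mem_filter.1 ht).2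
        exact Finset.mem_image.2 ⟨v, Finset.mem_univ _, not_not.1 hv⟩
      have hsplit := Finset.card_filter_add_card_filter_not (s := (Finset.univ : Finset (Fin n)))
        (fun t => ∀ v, (τ v : ℕ) ≠ t)
      rw [Finset.card_univ, Fintype.card_fin] at hsplit
      simp only [good]
      omega
    refine le_trans (Nat.mul_le_mul_left _ (Nat.pow_le_pow_right Fintype.card_pos
      (Nat.mul_le_mul_left _ hcard)))
      (N.card_isSilentOutside_mul_le (ZMod q) _ i _ hd hi good fun t ht u hu => ?_)
    have h1 := (Finset.mem_filter.1 ht).2 u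
    have h2 := not_or.1 hu
    have h3 : (τ u : ℕ) < t := lt_of_le_of_ne (not_lt.1 h2.2) h1
    exact ⟨⟨τ u, h3.trans t.2⟩, h3, not_or.2 ⟨h2.1, lt_irrefl _⟩⟩
  · have hS : (Finset.univ.image region).card ≤ (n + 1) ^ Fintype.card V := by
      refine Finset.card_image_le.trans (le_of_eq ?_)
      simp
    have h1 : (1 : ℝ) ≤ (q : ℝ) - 1 := by
      have : (2 : ℝ) ≤ q := by exact_mod_cast hq2
      linarith
    rw [ZMod.card]
    calc ((Finset.univ.image region).card : ℝ) * (q : ℝ) ^ m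
        ≤ ((n + 1) ^ Fintype.card V * q ^ m : ℕ) := by
          push_cast
          refine mul_le_mul_of_nonneg_right ?_ (by positivity)
          exact_mod_cast hS
      _ < (q ^ (N.capacity * (n - Fintype.card V)) : ℕ) := by exact_mod_cast h
      _ ≤ _ := by
          push_cast
          exact le_mul_of_one_le_left (by positivity) h1

/-- The signals that a causal code transmits solve the linear system of its matrices. -/
theorem transformsInto_of_hasSumCode [Fintype V] [Fact q.Prime] (N : FFNetwork q V K) {n m : ℕ}
    (h : N.HasSumCode (ZMod q) (fun s t : Fin n => s < t) m) : N.TransformsInto n m := by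
  classical
  obtain ⟨P, R, D, hP, hR, hD, hout⟩ := h
  let c : N.LinearCode n m :=
    { pre := fun v i t => Matrix.of fun a k =>
        if ht : t < n then P i (⟨v, a⟩, ⟨t, ht⟩) k else 0
      relay := fun v t s => Matrix.of fun a b =>
        if hts : t < n ∧ s < n then R (⟨v, a⟩, ⟨t, hts.1⟩) (⟨v, b⟩, ⟨s, hts.2⟩) else 0
      dec := fun t => Matrix.of fun k b => D k (⟨N.receiver, b⟩, t) }
  refine ⟨c, fun x' => ?_⟩
  let x : N.TxIndex × Fin n → ZMod q := fun z => c.transmit x' z.2 z.1.1 z.1.2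
  have hG : ∀ y, (N.timedChannelMatrix (ZMod q) (Fin n) *ᵥ x) y =
      N.channel (c.transmit x' y.2) y.1.1 y.1.2 := fun y => by
    rw [timedChannelMatrix_mulVec]
    exact N.channelMatrix_mulVec (fun u => c.transmit x' y.2 u) y.1
  have hsys : x = ∑ i, P i *ᵥ x' i + R *ᵥ (N.timedChannelMatrix (ZMod q) (Fin n) *ᵥ x) := by
    ext ⟨⟨v, a⟩, t⟩
    rw [Pi.add_apply, Finset.sum_apply]
    change c.transmit x' t v a = _
    rw [LinearCode.transmit]
    by_cases hv : v = N.receiver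
    · rw [if_pos hv, Pi.zero_apply]
      have h1 : ∑ i, (P i *ᵥ x' i) (⟨v, a⟩, t) = 0 := Finset.sum_eq_zero fun i _ => by
        simp [Matrix.mulVec, hP i (⟨v, a⟩, t) (hv ▸ (N.sender_ne_receiver i).symm)]
      have h2 : (R *ᵥ (N.timedChannelMatrix (ZMod q) (Fin n) *ᵥ x)) (⟨v, a⟩, t) = 0 := by
        refine Finset.sum_eq_zero fun y _ => mul_eq_zero_of_left ?_ _
        by_contra hne
        obtain ⟨h1, -, h3⟩ := hR _ _ hne
        exact h3 (h1.symm.trans hv)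
      rw [h1, h2, add_zero]
    · rw [if_neg hv, Pi.add_apply, Finset.sum_apply, Finset.sum_apply, Finset.sum_filter]
      congr 1
      · refine Finset.sum_congr rfl fun i _ => ?_
        split_ifs with hi
        · simp [c, Matrix.mulVec, dotProduct]
        · simp [Matrix.mulVec, hP i (⟨v, a⟩, t) fun hvi => hi hvi.symm]
      · let f (s : ℕ) : ZMod q := (c.relay v t s *ᵥ N.channel (fun u => c.transmit x' s u) v) a
        have hf : ∀ s : Fin n, f s = ∑ b, R (⟨v, a⟩, t) (⟨v, b⟩, s) *
            (N.timedChannelMatrix (ZMod q) (Fin n) *ᵥ x) (⟨v, b⟩, s) := fun s => by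
          simp only [hG]
          simp [f, c, Matrix.mulVec, dotProduct]
        calc ∑ s : Fin t, f s = ∑ s ∈ Finset.range t, f s := Fin.sum_univ_eq_sum_range f t
          _ = ∑ s ∈ Finset.range n, f s := by
              refine Finset.sum_subset (Finset.range_subset_range.2 t.2.le) fun s hs hst => ?_
              have hsn : s < n := Finset.mem_range.1 hs
              refine (hf ⟨s, hsn⟩).trans (Finset.sum_eq_zero fun b _ => mul_eq_zero_of_left ?_ _)
              by_contra hne
              exact hst (Finset.mem_range.2 (hR _ _ hne).2.1)
          _ = ∑ s : Fin n, f s := (Fin.sum_univ_eq_sum_range f n).symm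
          _ = ∑ y : N.RxIndex × Fin n, R (⟨v, a⟩, t) y *
                (N.timedChannelMatrix (ZMod q) (Fin n) *ᵥ x) y := by
              rw [Fintype.sum_prod_type_right]
              refine Finset.sum_congr rfl fun s _ => ?_
              rw [hf, Fintype.sum_sigma, Finset.sum_eq_single v]
              · intro v' _ hv'
                refine Finset.sum_eq_zero fun b _ => mul_eq_zero_of_left ?_ _
                by_contra hne
                exact hv' (hR _ _ hne).1.symm
              · exact fun h => absurd (Finset.mem_univ _) h
  rw [← hout x' x hsys]
  ext k
  rw [LinearCode.output, Finset.sum_apply]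
  change _ = ∑ y : N.RxIndex × Fin n, D k y * (N.timedChannelMatrix (ZMod q) (Fin n) *ᵥ x) y
  rw [Fintype.sum_prod_type_right]
  refine Finset.sum_congr rfl fun s _ => ?_
  have hdec : ∑ b, D k (⟨N.receiver, b⟩, s) *
      (N.timedChannelMatrix (ZMod q) (Fin n) *ᵥ x) (⟨N.receiver, b⟩, s) =
      (c.dec s *ᵥ N.channel (c.transmit x' s) N.receiver) k := by
    simp only [hG]
    simp [c, Matrix.mulVec, dotProduct]
  refine hdec.symm.trans ?_
  rw [Fintype.sum_sigma, Finset.sum_eq_single N.receiver]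
  · exact fun v _ hne => Finset.sum_eq_zero fun b _ => mul_eq_zero_of_left (hD k (⟨v, b⟩, s) hne) _
  · exact fun h => absurd (Finset.mem_univ _) h

/-- The length of the messages is `C * n` up to a logarithmic term. -/
theorem exists_transformsInto [Fact q.Prime] [Fintype V] (N : FFNetwork q V K) :
    ∃ m : ℕ → ℕ,
      Filter.Tendsto (fun n : ℕ => (m n : ℝ) / (n : ℝ)) Filter.atTop (nhds (N.capacity : ℝ)) ∧
        ∀ n, N.TransformsInto n (m n) := by
  have hq2 : 2 ≤ q := (Fact.out : q.Prime).two_le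
  -- `q ^ loss n` exceeds the number `(n + 1) ^ |V|` of active regions.
  let loss (n : ℕ) : ℕ := Fintype.card V * (Nat.log 2 (n + 1) + 1) + 1
  refine ⟨fun n => N.capacity * (n - Fintype.card V) - loss n, ?_, fun n => ?_⟩
  · have hn : Filter.Tendsto (fun n : ℕ => (1 : ℝ) / n) Filter.atTop (nhds 0) :=
      tendsto_one_div_atTop_nhds_zero_nat
    have hlog : Filter.Tendsto (fun n : ℕ => Real.log n / n) Filter.atTop (nhds 0) :=
      Real.isLittleO_log_id_atTop.tendsto_div_nhds_zero.comp tendsto_natCast_atTop_atTop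
    have hlower : Filter.Tendsto (fun n : ℕ => (N.capacity : ℝ) -
        ((N.capacity * Fintype.card V + 2 * Fintype.card V + 1) * (1 / (n : ℝ)) +
          Fintype.card V / Real.log 2 * (Real.log n / n))) Filter.atTop
        (nhds (N.capacity : ℝ)) := by
      simpa using tendsto_const_nhds.sub ((hn.const_mul _).add (hlog.const_mul _))
    refine tendsto_of_tendsto_of_tendsto_of_le_of_le' hlower tendsto_const_nhds ?_ ?_
    · filter_upwards [Filter.eventually_ge_atTop 1] with n hn1
      have hn1' : (1 : ℝ) ≤ n := by exact_mod_cast hn1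
      have hlog2 : 0 < Real.log 2 := Real.log_pos one_lt_two
      have hL : (Nat.log 2 (n + 1) : ℝ) ≤ 1 + Real.log n / Real.log 2 := by
        calc (Nat.log 2 (n + 1) : ℝ) ≤ Real.logb 2 (n + 1 : ℕ) := Real.natLog_le_logb _ _
          _ ≤ Real.logb 2 (2 * n) := by
              refine Real.logb_le_logb_of_le one_lt_two (by positivity) ?_
              push_cast
              linarith
          _ = 1 + Real.log n / Real.log 2 := by
              rw [Real.logb, Real.log_mul two_ne_zero (by positivity), add_div,
                div_self hlog2.ne']
      have hm : (N.capacity : ℝ) * n ≤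
          ((N.capacity * (n - Fintype.card V) - loss n : ℕ) : ℝ) +
            (N.capacity * Fintype.card V + loss n) := by
        have h1 : N.capacity * n ≤ N.capacity * (n - Fintype.card V) - loss n +
            (N.capacity * Fintype.card V + loss n) := by
          have h2 : N.capacity * n ≤ N.capacity * (n - Fintype.card V) +
              N.capacity * Fintype.card V := by
            rw [← mul_add]
            exact Nat.mul_le_mul_left _ le_tsub_add
          omega
        exact_mod_cast h1
      have hloss : (loss n : ℝ) ≤
          Fintype.card V * (2 + Real.log n / Real.log 2) + 1 := by
        simp only [loss]
        push_cast
        have := mul_le_mul_of_nonneg_left hL (Nat.cast_nonneg (α := ℝ) (Fintype.card V))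
        linarith
      rw [le_div_iff₀ (by positivity)]
      have : ((N.capacity : ℝ) -
          ((N.capacity * Fintype.card V + 2 * Fintype.card V + 1) * (1 / (n : ℝ)) +
            Fintype.card V / Real.log 2 * (Real.log n / n))) * n =
          N.capacity * n - (N.capacity * Fintype.card V +
            (Fintype.card V * (2 + Real.log n / Real.log 2) + 1)) := by
        field_simp
        ring
      rw [this]
      linarith
    · filter_upwards [Filter.eventually_ge_atTop 1] with n hn1
      have hn1' : (0 : ℝ) < n := by exact_mod_cast hn1
      rw [div_le_iff₀ hn1']
      exact_mod_cast (Nat.sub_le _ _).trans (Nat.mul_le_mul_left _ (Nat.sub_le _ _))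
  · by_cases hm : N.capacity * (n - Fintype.card V) ≤ loss n
    -- Messages of length zero need no code.
    · simp only [Nat.sub_eq_zero_of_le hm]
      exact ⟨⟨fun _ _ _ => 0, fun _ _ _ => 0, fun _ => 0⟩, fun _ => Subsingleton.elim _ _⟩
    · refine N.transformsInto_of_hasSumCode (N.hasSumCode_causal n _ ?_)
      have h1 : (n + 1) ^ Fintype.card V < q ^ loss n := by
        calc (n + 1) ^ Fintype.card V ≤ (2 ^ (Nat.log 2 (n + 1) + 1)) ^ Fintype.card V :=
              Nat.pow_le_pow_left (Nat.lt_pow_succ_log_self one_lt_two _).le _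
          _ = 2 ^ (Fintype.card V * (Nat.log 2 (n + 1) + 1)) := by rw [← pow_mul, mul_comm]
          _ ≤ q ^ (Fintype.card V * (Nat.log 2 (n + 1) + 1)) := Nat.pow_le_pow_left hq2 _
          _ < q ^ loss n := Nat.pow_lt_pow_right hq2 (Nat.lt_succ_self _)
      calc _ < q ^ loss n * q ^ (N.capacity * (n - Fintype.card V) - loss n) :=
            Nat.mul_lt_mul_of_pos_right h1 (by positivity)
        _ = q ^ (N.capacity * (n - Fintype.card V)) := by
            rw [← pow_add, Nat.add_sub_cancel' (le_of_not_ge hm)]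

/-! ### Layered networks -/

/-- In a layered network a single use over a large field is enough, since every relay may use what
it receives without a delay. -/
theorem IsLayered.hasSumCode [Fact q.Prime] [Fintype V] {N : FFNetwork q V K} (hN : N.IsLayered)
    (F : Type*) [Field F] [Fintype F] [Algebra (ZMod q) F]
    (hF : 2 ^ Fintype.card V + 1 < Fintype.card F) :
    N.HasSumCode F (fun _ _ : Unit => True) N.capacity := by
  classical
  obtain ⟨-, layer, -, -, -, hlayer⟩ := hN
  refine N.hasSumCode_of_card_lt F (T := Unit) _ (fun v _ => layer v)
    (fun u v _ _ h _ => by rw [hlayer u v h]; exact Nat.lt_succ_self _)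
    Finset.univ (fun _ => Finset.mem_univ _) N.capacity N.capacity ?_ ?_
  · intro i S _ hd hi
    simpa using N.card_isSilentOutside_mul_le F (fun _ _ : Unit => True) i S hd hi Finset.univ
      fun t _ u hu => ⟨t, trivial, hu⟩
  · have hQ : (0 : ℝ) < Fintype.card F := Nat.cast_pos.2 Fintype.card_pos
    refine mul_lt_mul_of_pos_right ?_ (pow_pos hQ _)
    rw [Finset.card_univ, Fintype.card_set, Fintype.card_prod, Fintype.card_unit, mul_one,
      lt_sub_iff_add_lt]
    exact_mod_cast hF

section Coordinates

variable [Fact q.Prime] {F : Type*} [Field F] [Algebra (ZMod q) F] {n : ℕ}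
  (b : Module.Basis (Fin n) (ZMod q) F)

/-- A matrix over an extension field acts on coordinate vectors by the blocks of its entries'
multiplication matrices. -/
theorem repr_mulVec {X Y : Type*} [Fintype X] (A : Matrix Y X F) (z : X → F) (y : Y) (j : Fin n) :
    b.repr ((A *ᵥ z) y) j =
      ∑ p : Fin n × X, Algebra.leftMulMatrix b (A y p.2) j p.1 * b.repr (z p.2) p.1 := by
  have h : ∀ x, b.repr (A y x * z x) j =
      ∑ j', Algebra.leftMulMatrix b (A y x) j j' * b.repr (z x) j' := fun x => by
    rw [← Algebra.leftMulMatrix_mulVec_repr]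
    rfl
  simp only [Matrix.mulVec, dotProduct, map_sum, Finsupp.coe_finsetSum, Finset.sum_apply, h]
  rw [Fintype.sum_prod_type, Finset.sum_comm]

/-- Signals over an extension field correspond to blocks of signals over the base field. -/
noncomputable def blockEquiv (N : FFNetwork q V K) :
    (N.TxIndex × Unit → F) ≃ (∀ u : V, Fin n × Fin (N.α u) → ZMod q) where
  toFun z u p := b.repr (z (⟨u, p.2⟩, ())) p.1
  invFun x z := b.equivFun.symm fun j => x z.1.1 (j, z.1.2)
  left_inv z := by
    ext ⟨⟨u, a⟩, ⟨⟩⟩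
    exact b.equivFun.symm_apply_apply (z (⟨u, a⟩, ()))
  right_inv x := by
    ext u p
    exact congrFun (b.equivFun.apply_symm_apply fun j => x u (j, p.2)) p.1

theorem extendedChannel_blockEquiv [Fintype V] (N : FFNetwork q V K) (z : N.TxIndex × Unit → F)
    (v : V) (p : Fin n × Fin (N.β v)) :
    N.extendedChannel n (blockEquiv b N z) v p =
      b.repr ((N.timedChannelMatrix F Unit *ᵥ z) (⟨v, p.2⟩, ())) p.1 := by
  classical
  rw [timedChannelMatrix_mulVec]
  simp only [extendedChannel, extendedMatrix, blockEquiv, Equiv.coe_fn_mk, channelMatrix,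
    Matrix.mulVec, dotProduct, Finset.sum_filter, Finset.sum_apply, Matrix.of_apply,
    Fintype.sum_sigma, map_sum, Finsupp.coe_finsetSum]
  refine Finset.sum_congr rfl fun u _ => ?_
  split_ifs with h
  · rw [Fintype.sum_prod_type_right]
    refine Finset.sum_congr rfl fun a _ => ?_
    rw [← Algebra.smul_def, map_smul]
    simp [Matrix.kroneckerMap_apply, Matrix.one_apply]
  · simp

/-- Restriction of scalars turns a code for single symbols of the extension field into a block
code over the base field. -/
theorem IsLayered.blockTransformsInto [Fintype V] {N : FFNetwork q V K} (hN : N.IsLayered) {m : ℕ}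
    (b : Module.Basis (Fin n) (ZMod q) F) (h : N.HasSumCode F (fun _ _ : Unit => True) m) :
    N.BlockTransformsInto n (n * m) := by
  classical
  obtain ⟨P, R, D, hP, hR, hD, hout⟩ := h
  obtain ⟨-, layer, -, -, -, hlayer⟩ := hN
  let G := N.timedChannelMatrix F Unit
  let e : Fin (n * m) ≃ Fin n × Fin m := finProdFinEquiv.symm
  let c : N.BlockCode n (n * m) :=
    { pre := fun v i => Matrix.of fun p k =>
        Algebra.leftMulMatrix b (P i (⟨v, p.2⟩, ()) (e k).2) p.1 (e k).1
      relay := fun v => Matrix.of fun p p' =>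
        Algebra.leftMulMatrix b (R (⟨v, p.2⟩, ()) (⟨v, p'.2⟩, ())) p.1 p'.1
      dec := Matrix.of fun k p =>
        Algebra.leftMulMatrix b (D (e k).2 (⟨N.receiver, p.2⟩, ())) (e k).1 p.1 }
  refine ⟨c, fun x' => ?_⟩
  -- The messages, read as vectors over `F`.
  let w (i : Fin K) (k : Fin m) : F := b.equivFun.symm fun j => x' i (e.symm (j, k))
  have hw : ∀ i k, b.repr (w i (e k).2) (e k).1 = x' i k := fun i k => by
    refine (congrFun (b.equivFun.apply_symm_apply _) _).trans ?_
    simp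
  have hpre : ∀ i v (p : Fin n × Fin (N.α v)),
      (c.pre v i *ᵥ x' i) p = b.repr ((P i *ᵥ w i) (⟨v, p.2⟩, ())) p.1 := fun i v p => by
    rw [repr_mulVec, ← e.sum_comp]
    simp only [hw]
    rfl
  have hrelay : ∀ z v (p : Fin n × Fin (N.α v)),
      (c.relay v *ᵥ N.extendedChannel n (blockEquiv b N z) v) p =
        b.repr ((R *ᵥ (G *ᵥ z)) (⟨v, p.2⟩, ())) p.1 := fun z v p => by
    rw [repr_mulVec, Fintype.sum_prod_type]
    simp only [Matrix.mulVec, dotProduct]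
    rw [Fintype.sum_prod_type]
    refine Finset.sum_congr rfl fun j _ => ?_
    rw [Fintype.sum_prod_type, Fintype.sum_sigma, Finset.sum_eq_single v]
    · simp only [extendedChannel_blockEquiv]
      simp [c, G, Matrix.mulVec, dotProduct]
    · intro v' _ hv'
      refine Finset.sum_eq_zero fun a _ => ?_
      have : R (⟨v, p.2⟩, ()) (⟨v', a⟩, ()) = 0 := by
        by_contra hne
        exact hv' (hR _ _ hne).1.symm
      simp [this]
    · exact fun h => absurd (Finset.mem_univ _) h
  have hrun : ∀ z, c.IsRun x' (blockEquiv b N z) ↔ z = ∑ i, P i *ᵥ w i + R *ᵥ (G *ᵥ z) := by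
    intro z
    have hcoord : z = ∑ i, P i *ᵥ w i + R *ᵥ (G *ᵥ z) ↔ ∀ v, blockEquiv b N z v =
        blockEquiv b N (∑ i, P i *ᵥ w i + R *ᵥ (G *ᵥ z)) v := by
      rw [← funext_iff, (blockEquiv b N).apply_eq_iff_eq]
    have hrec : blockEquiv b N (∑ i, P i *ᵥ w i + R *ᵥ (G *ᵥ z)) N.receiver = 0 := by
      ext p
      have h1 : ∑ i, (P i *ᵥ w i) (⟨N.receiver, p.2⟩, ()) = 0 :=
        Finset.sum_eq_zero fun i _ => by
          simp [Matrix.mulVec, hP i (⟨N.receiver, p.2⟩, ()) (N.sender_ne_receiver i).symm]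
      have h2 : (R *ᵥ (G *ᵥ z)) (⟨N.receiver, p.2⟩, ()) = 0 := by
        refine Finset.sum_eq_zero fun y _ => mul_eq_zero_of_left ?_ _
        by_contra hne
        obtain ⟨h1, -, h3⟩ := hR _ _ hne
        exact h3 h1.symm
      change b.repr ((∑ i, P i *ᵥ w i + R *ᵥ (G *ᵥ z)) (⟨N.receiver, p.2⟩, ())) p.1 = 0
      rw [Pi.add_apply, Finset.sum_apply, h1, h2, add_zero, map_zero, Finsupp.zero_apply]
    have hother : ∀ v, ∑ i : Fin K with N.sender i = v, c.pre v i *ᵥ x' i +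
        c.relay v *ᵥ N.extendedChannel n (blockEquiv b N z) v =
        blockEquiv b N (∑ i, P i *ᵥ w i + R *ᵥ (G *ᵥ z)) v := by
      intro v
      ext p
      rw [Pi.add_apply, hrelay, Finset.sum_apply, Finset.sum_filter]
      simp only [blockEquiv, Equiv.coe_fn_mk, Pi.add_apply, Finset.sum_apply, map_add, map_sum,
        Finsupp.coe_add, Finsupp.coe_finsetSum]
      congr 1
      refine Finset.sum_congr rfl fun i _ => ?_
      split_ifs with hi
      · exact hpre i v p
      · simp [Matrix.mulVec, hP i (⟨v, p.2⟩, ()) fun hvi => hi hvi.symm]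
    rw [hcoord]
    constructor
    · rintro ⟨h1, h2⟩ v
      by_cases hv : v = N.receiver
      · subst hv
        rw [h1, hrec]
      · rw [← hother v]
        exact h2 v hv
    · intro h
      exact ⟨(h _).trans hrec, fun v _ => (h v).trans (hother v).symm⟩
  have hRG : ∀ z, z = R *ᵥ (G *ᵥ z) → z = 0 := hR.eq_zero (fun v _ => layer v)
    fun u v _ _ huv _ => by rw [hlayer u v huv]; exact Nat.lt_succ_self _
  constructor
  · obtain ⟨z, hz, huniq⟩ := existsUnique_eq_add_mulVec G R hRG (∑ i, P i *ᵥ w i)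
    refine ⟨blockEquiv b N z, (hrun z).2 hz, fun x hx => ?_⟩
    obtain ⟨z', rfl⟩ := (blockEquiv b N).surjective x
    rw [huniq z' ((hrun z').1 hx)]
  · intro x hx
    obtain ⟨z, rfl⟩ := (blockEquiv b N).surjective x
    have hsum := hout w z ((hrun z).1 hx)
    ext k
    have hk : b.repr ((D *ᵥ (G *ᵥ z)) (e k).2) (e k).1 = ∑ i, x' i k := by
      rw [hsum]
      simp only [Finset.sum_apply, map_sum, Finsupp.coe_finsetSum, hw]
    rw [Finset.sum_apply, ← hk, repr_mulVec, Fintype.sum_prod_type]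
    simp only [Matrix.mulVec, dotProduct]
    rw [Fintype.sum_prod_type]
    refine Finset.sum_congr rfl fun j _ => ?_
    rw [Fintype.sum_prod_type, Fintype.sum_sigma, Finset.sum_eq_single N.receiver]
    · simp only [extendedChannel_blockEquiv]
      simp [c, G, Matrix.mulVec, dotProduct]
    · intro v _ hv
      refine Finset.sum_eq_zero fun a _ => ?_
      simp [hD (e k).2 (⟨v, a⟩, ()) hv]
    · exact fun h => absurd (Finset.mem_univ _) h

end Coordinates

end FFNetwork

theorem mainTheorem6 (q : ℕ) [Fact q.Prime] {V : Type*} [Fintype V] (K : ℕ) (hK : 0 < K)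
    (N : FFNetwork q V K) :
    (∃ m : ℕ → ℕ,
      Filter.Tendsto (fun n : ℕ => (m n : ℝ) / (n : ℝ)) Filter.atTop (nhds (N.capacity : ℝ)) ∧
        ∀ n, N.TransformsInto n (m n)) ∧
    (N.IsLayered →
      ∀ᶠ n : ℕ in Filter.atTop, N.BlockTransformsInto n (n * N.capacity)) := by
  refine ⟨N.exists_transformsInto, fun hN => ?_⟩
  filter_upwards [Filter.eventually_ge_atTop (Fintype.card V + 2)] with n hn
  have hn0 : n ≠ 0 := by omega
  have := Fintype.ofFinite (GaloisField q n)
  refine hN.blockTransformsInto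
    (Module.finBasisOfFinrankEq (ZMod q) (GaloisField q n) (GaloisField.finrank q hn0))
    (hN.hasSumCode (GaloisField q n) ?_)
  rw [Fintype.card_eq_nat_card (α := GaloisField q n), GaloisField.card q n hn0]
  calc 2 ^ Fintype.card V + 1 < 2 ^ (Fintype.card V + 2) := by
        have := Nat.one_le_two_pow (n := Fintype.card V)
        rw [pow_add]
        omega
    _ ≤ 2 ^ n := Nat.pow_le_pow_right two_pos hn
    _ ≤ q ^ n := Nat.pow_le_pow_left (Fact.out : q.Prime).two_le _
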